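/- Let $k$ be a field, $n\ge 1$, and let $<$ be a product order on $k[X]=k[X_1,\dots,X_n]$, that is, a term order such that, with $p:\mathbb{N}^n\to\mathbb{N}^{n-1}$ the projection forgetting the first entry, $\alpha<\beta$ holds whenever $p(\alpha)<p(\beta)$, or $p(\alpha)=p(\beta)$ and $\alpha_1<\beta_1$. Here exponents in $\mathbb{N}^{n-1}$ are compared by the restriction of $<$ to $k[X_2,\dots,X_n]$. For a variety $V$ in affine $N$-space over a field $K$ with (radical) ideal $I(V)$, and a term order on $K[X_1,\dots,X_N]$, let $D(V)\subseteq\mathbb{N}^N$ be the complement of the set of leading exponents of the nonzero elements of $I(V)$. Let $\mathbb{D}_N$ be the set of all $\delta\subseteq\mathbb{N}^N$ such that $\alpha\notin\delta$ implies $\alpha+\beta\notin\delta$ for all $\beta\in\mathbb{N}^N$; thus $D(V)\in\mathbb{D}_N$. Let $A$ be a closed subvariety of $\mathbb{A}^n$ over $k$ all of whose irreducible components are $d$-dimensional affine subspaces, i.e. each is defined by a solvable system of inhomogeneous linear equations over $k$ whose solution set has dimension $d$. For a closed point $\lambda$ of $\mathbb{A}^1=\operatorname{Spec}k[X_1]$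 with residue field $\kappa(\lambda)$, let $A_\lambda=A\cap\{X_1=\lambda\}$, a variety in affine $(n-1)$-space over $\kappa(\lambda)$ with coordinates $X_2,\dots,X_n$, and let $D(A_\lambda)\in\mathbb{D}_{n-1}$ be its standard set with respect to the restriction of $<$. Then there is a $\delta\in\mathbb{D}_{n-1}$ such that the set $U$ of all closed points $\lambda$ of $\mathbb{A}^1$ with $D(A_\lambda)=\delta$ is dense, the set $Y$ of the remaining closed points is finite, and $$D(A)\supseteq(\mathbb{N}e_1\oplus\delta)\cup\sum_{\lambda\in Y}D(A_\lambda).$$ Moreover, $\mathbb{N}e_1\oplus\delta$ is the largest subset of $D(A)$ that is a union of $1$-planes parallel to $\mathbb{N}e_1$, i.e. of sets $\gamma+\mathbb{N}e_1$ with $\gamma\in\mathbb{N}^n$, $\gamma_1=0$. Here $\mathbb{N}e_1\oplus\delta=\{\alpha\in\mathbb{N}^n : p(\alpha)\in\delta\}$. Each $D(A_\lambda)$ is regarded as a subset of $\mathbb{N}^n$ via $(\alpha_2,\dots,\alpha_n)\mapsto(0,\alpha_2,\dots,\alpha_n)$. The sum is taken in the commutative monoid of those elements of $\mathbb{D}_n$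 that do not contain $\mathbb{N}e_1$, with neutral element $\emptyset$ and addition $$\delta'+\delta''=\{\beta\in\mathbb{N}^n : p(\beta)\in p(\delta')\cup p(\delta''),\ \beta_1<\#(p^{-1}(p(\beta))\cap\delta')+\#(p^{-1}(p(\beta))\cap\delta'')\}.$$ -/

import Mathlib

/-! Standard sets of finite unions of affine `d`-planes.

Affine space of dimension `N` over `k` has coordinates indexed by `Fin N`.  When a first coordinate
`X₁` is singled out the dimension is written `n + 1`: index `0` is `X₁`, and the indices `i.succ`,
`i : Fin n`, are the other coordinates.  The projection `p : ℕ^(n+1) → ℕ^n` that forgets the first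
entry is `Finsupp.tail`, and `(a, α)` is `Finsupp.cons a α`. -/

noncomputable section

namespace PlaneVarieties

open MvPolynomial MonomialOrder

/-! ### Subsets of `ℕ^N` -/

/-- The set `𝔻_N` of all `δ ⊆ ℕ^N` whose complement is stable under adding elements of `ℕ^N`. -/
def StandardSets (N : ℕ) : Set (Set (Fin N →₀ ℕ)) :=
  {δ | ∀ α, α ∉ δ → ∀ β, α + β ∉ δ}

/-- The set `γ + ⊕_{i ∈ J} ℕ e_i`. -/
def coordPlane {N : ℕ} (J : Finset (Fin N)) (γ : Fin N →₀ ℕ) : Set (Fin N →₀ ℕ) :=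
  {α | ∃ β : Fin N →₀ ℕ, β.support ⊆ J ∧ α = γ + β}

/-- `S` is a union of planes parallel to `⊕_{i ∈ J} ℕ e_i`, i.e. of sets `γ + ⊕_{i ∈ J} ℕ e_i`
with `γ_j = 0` for all `j ∈ J`. -/
def IsUnionOfPlanes {N : ℕ} (J : Finset (Fin N)) (S : Set (Fin N →₀ ℕ)) : Prop :=
  ∃ Γ : Set (Fin N →₀ ℕ), (∀ γ ∈ Γ, ∀ j ∈ J, γ j = 0) ∧ S = ⋃ γ ∈ Γ, coordPlane J γ

/-- `ℕ e₁ ⊕ δ = {α ∈ ℕ^(n+1) | p(α) ∈ δ}`. -/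
def cuboid {n : ℕ} (δ : Set (Fin n →₀ ℕ)) : Set (Fin (n + 1) →₀ ℕ) :=
  {α | α.tail ∈ δ}

/-! ### Addition of standard sets -/

/-- The set of those elements of `𝔻_(n+1)` that do not contain `ℕ e₁`. -/
def BoundedStandardSets (n : ℕ) : Set (Set (Fin (n + 1) →₀ ℕ)) :=
  {δ | δ ∈ StandardSets (n + 1) ∧ ¬ coordPlane {0} 0 ⊆ δ}

/-- The fibre `p⁻¹(α) ∩ δ`. -/
def fibre {n : ℕ} (δ : Set (Fin (n + 1) →₀ ℕ)) (α : Fin n →₀ ℕ) : Set (Fin (n + 1) →₀ ℕ) :=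
  {β | β ∈ δ ∧ β.tail = α}

/-- The sum of `δ` and `δ'`: all `β` with `p(β) ∈ p(δ) ∪ p(δ')` and
`β₁ < #(p⁻¹(p(β)) ∩ δ) + #(p⁻¹(p(β)) ∩ δ')`. -/
def addSets {n : ℕ} (δ δ' : Set (Fin (n + 1) →₀ ℕ)) : Set (Fin (n + 1) →₀ ℕ) :=
  {β | β.tail ∈ Finsupp.tail '' δ ∪ Finsupp.tail '' δ' ∧
    β 0 < (fibre δ β.tail).ncard + (fibre δ' β.tail).ncard}

theorem mem_of_le {N : ℕ} {δ : Set (Fin N →₀ ℕ)} (hδ : δ ∈ StandardSets N) {α β : Fin N →₀ ℕ}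
    (h : α ≤ β) (hβ : β ∈ δ) : α ∈ δ := by
  by_contra hα
  have := hδ α hα (β - α)
  rw [add_tsub_cancel_of_le h] at this
  exact this hβ

theorem cons_le_cons {n : ℕ} {a b : ℕ} {α β : Fin n →₀ ℕ} (h : a ≤ b) (h' : α ≤ β) :
    Finsupp.cons a α ≤ Finsupp.cons b β := by
  intro i
  refine Fin.cases ?_ (fun j => ?_) i
  · simpa using h
  · simpa using h' j

theorem tail_le_tail {n : ℕ} {α β : Fin (n + 1) →₀ ℕ} (h : α ≤ β) : α.tail ≤ β.tail :=
  fun i => h i.succ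

theorem ncard_cons_lt {n : ℕ} (c : ℕ) (α : Fin n →₀ ℕ) :
    {γ : Fin (n + 1) →₀ ℕ | γ.tail = α ∧ γ 0 < c}.ncard = c := by
  have : {γ : Fin (n + 1) →₀ ℕ | γ.tail = α ∧ γ 0 < c}
      = (fun a => Finsupp.cons a α) '' (Finset.range c : Set ℕ) := by
    ext γ
    simp only [Set.mem_ofPred_eq, Set.mem_image, Finset.coe_range, Set.mem_Iio]
    constructor
    · rintro ⟨rfl, h⟩
      exact ⟨γ 0, h, Finsupp.cons_tail γ⟩
    · rintro ⟨a, ha, rfl⟩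
      simpa using ha
  rw [this, Set.ncard_image_of_injective, Set.ncard_coe_finset, Finset.card_range]
  intro a b hab
  simpa using DFunLike.congr_fun hab 0

/-- Each fibre of an element of `BoundedStandardSets` is an initial segment of a line. -/
theorem exists_height {n : ℕ} {δ : Set (Fin (n + 1) →₀ ℕ)} (hδ : δ ∈ BoundedStandardSets n)
    (α : Fin n →₀ ℕ) : ∃ c, fibre δ α = {γ | γ.tail = α ∧ γ 0 < c} := by
  classical
  have hex : ∃ c, Finsupp.cons c α ∉ δ := by
    by_contra! hc
    apply hδ.2
    rintro β ⟨β', hβ', rfl⟩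
    rw [zero_add]
    refine mem_of_le hδ.1 ?_ (hc (β' 0))
    intro i
    refine Fin.cases (by simp) (fun j => ?_) i
    have : β' j.succ = 0 := by
      by_contra hne
      have := hβ' (Finsupp.mem_support_iff.2 hne)
      simp at this
    simp [this]
  refine ⟨Nat.find hex, ?_⟩
  ext γ
  simp only [fibre, Set.mem_ofPred_eq]
  constructor
  · rintro ⟨h, rfl⟩
    refine ⟨rfl, ?_⟩
    by_contra! hle
    refine Nat.find_spec hex (mem_of_le hδ.1 ?_ h)
    conv_rhs => rw [← Finsupp.cons_tail γ]
    exact cons_le_cons hle le_rfl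
  · rintro ⟨rfl, h⟩
    have := Nat.find_min hex h
    rw [not_not, Finsupp.cons_tail] at this
    exact ⟨this, rfl⟩

theorem mem_iff_lt_ncard {n : ℕ} {δ : Set (Fin (n + 1) →₀ ℕ)} (hδ : δ ∈ BoundedStandardSets n)
    (β : Fin (n + 1) →₀ ℕ) : β ∈ δ ↔ β 0 < (fibre δ β.tail).ncard := by
  obtain ⟨c, hc⟩ := exists_height hδ β.tail
  have h : β ∈ fibre δ β.tail ↔ β 0 < c := by rw [hc]; simp
  rw [hc, ncard_cons_lt, ← h]
  simp [fibre]

theorem mem_addSets {n : ℕ} {δ δ' : Set (Fin (n + 1) →₀ ℕ)} {β : Fin (n + 1) →₀ ℕ} :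
    β ∈ addSets δ δ' ↔ β 0 < (fibre δ β.tail).ncard + (fibre δ' β.tail).ncard := by
  refine ⟨fun h => h.2, fun h => ⟨?_, h⟩⟩
  rcases Nat.eq_zero_or_pos (fibre δ β.tail).ncard with h0 | h0
  · have h1 : (fibre δ' β.tail).ncard ≠ 0 := by omega
    obtain ⟨γ, hγ, hγ'⟩ := Set.nonempty_of_ncard_ne_zero h1
    exact Or.inr ⟨γ, hγ, hγ'⟩
  · obtain ⟨γ, hγ, hγ'⟩ := Set.nonempty_of_ncard_ne_zero h0.ne'
    exact Or.inl ⟨γ, hγ, hγ'⟩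

theorem ncard_fibre_addSets {n : ℕ} (δ δ' : Set (Fin (n + 1) →₀ ℕ)) (α : Fin n →₀ ℕ) :
    (fibre (addSets δ δ') α).ncard = (fibre δ α).ncard + (fibre δ' α).ncard := by
  rw [← ncard_cons_lt ((fibre δ α).ncard + (fibre δ' α).ncard) α]
  congr 1
  ext γ
  simp only [fibre, Set.mem_ofPred_eq]
  constructor
  · rintro ⟨h, rfl⟩
    exact ⟨rfl, mem_addSets.1 h⟩
  · rintro ⟨rfl, h⟩
    exact ⟨mem_addSets.2 h, rfl⟩

theorem ncard_fibre_anti {n : ℕ} {δ : Set (Fin (n + 1) →₀ ℕ)} (hδ : δ ∈ BoundedStandardSets n)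
    {α β : Fin n →₀ ℕ} (h : α ≤ β) : (fibre δ β).ncard ≤ (fibre δ α).ncard := by
  by_contra! hlt
  have h1 := (mem_iff_lt_ncard hδ (Finsupp.cons (fibre δ α).ncard β)).2 (by simpa using hlt)
  have h2 := mem_of_le hδ.1 (cons_le_cons (le_refl (fibre δ α).ncard) h) h1
  have h3 := (mem_iff_lt_ncard hδ _).1 h2
  simp at h3

theorem addSets_mem {n : ℕ} {δ δ' : Set (Fin (n + 1) →₀ ℕ)} (hδ : δ ∈ BoundedStandardSets n)
    (hδ' : δ' ∈ BoundedStandardSets n) : addSets δ δ' ∈ BoundedStandardSets n := by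
  constructor
  · intro α hα β hαβ
    apply hα
    rw [mem_addSets] at hαβ ⊢
    have hle : α ≤ α + β := le_self_add
    have h0 : α 0 ≤ (α + β) 0 := hle 0
    have h1 := ncard_fibre_anti hδ (tail_le_tail hle)
    have h2 := ncard_fibre_anti hδ' (tail_le_tail hle)
    omega
  · intro hsub
    have := hsub (a := Finsupp.cons ((fibre δ 0).ncard + (fibre δ' 0).ncard) 0)
      ⟨Finsupp.single 0 ((fibre δ 0).ncard + (fibre δ' 0).ncard),
        Finsupp.support_single_subset,
        by rw [zero_add, Finsupp.cons_zero_eq_single_zero]⟩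
    rw [mem_addSets] at this
    simp at this

theorem empty_mem (n : ℕ) : (∅ : Set (Fin (n + 1) →₀ ℕ)) ∈ BoundedStandardSets n :=
  ⟨fun _ _ _ h => h, fun h => h (a := (0 : Fin (n + 1) →₀ ℕ)) ⟨0, by simp, by simp⟩⟩

instance (n : ℕ) : Add (BoundedStandardSets n) := ⟨fun δ δ' => ⟨_, addSets_mem δ.2 δ'.2⟩⟩

instance (n : ℕ) : Zero (BoundedStandardSets n) := ⟨⟨∅, empty_mem n⟩⟩

theorem ext_ncard {n : ℕ} {δ δ' : BoundedStandardSets n}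
    (h : ∀ α, (fibre δ.1 α).ncard = (fibre δ'.1 α).ncard) : δ = δ' := by
  apply Subtype.ext
  ext β
  rw [mem_iff_lt_ncard δ.2, mem_iff_lt_ncard δ'.2, h]

theorem ncard_fibre_add {n : ℕ} (δ δ' : BoundedStandardSets n) (α : Fin n →₀ ℕ) :
    (fibre (δ + δ').1 α).ncard = (fibre δ.1 α).ncard + (fibre δ'.1 α).ncard :=
  ncard_fibre_addSets _ _ _

theorem ncard_fibre_zero {n : ℕ} (α : Fin n →₀ ℕ) :
    (fibre (0 : BoundedStandardSets n).1 α).ncard = 0 := by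
  have : fibre (0 : BoundedStandardSets n).1 α = ∅ := by
    ext γ
    simp only [fibre, Set.mem_ofPred_eq, Set.mem_empty_iff_false, iff_false]
    rintro ⟨h, -⟩
    exact h
  rw [this, Set.ncard_empty]

/-- Addition of standard sets is commutative and associative with neutral element `∅`, so that
finite sums make sense. -/
instance (n : ℕ) : AddCommMonoid (BoundedStandardSets n) where
  add_assoc a b c := ext_ncard fun α => by simp only [ncard_fibre_add, add_assoc]
  zero_add a := ext_ncard fun α => by simp only [ncard_fibre_add, ncard_fibre_zero, zero_add]
  add_zero a := ext_ncard fun α => by simp only [ncard_fibre_add, ncard_fibre_zero, add_zero]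
  add_comm a b := ext_ncard fun α => by simp only [ncard_fibre_add, add_comm]
  nsmul := nsmulRec

/-- The embedding of `𝔻_n` given by `(α₂, …) ↦ (0, α₂, …)`. -/
def embed {n : ℕ} (δ : StandardSets n) : BoundedStandardSets n :=
  ⟨Finsupp.cons 0 '' δ.1, by
    constructor
    · rintro α hα β ⟨γ, hγ, hγ'⟩
      apply hα
      have h0 : (0 : ℕ) = α 0 + β 0 := by simpa using DFunLike.congr_fun hγ' 0
      refine ⟨α.tail, mem_of_le δ.2 (fun i => ?_) hγ, ?_⟩
      · have := DFunLike.congr_fun hγ' i.succ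
        simp only [Finsupp.cons_succ, Finsupp.add_apply] at this
        rw [Finsupp.tail_apply]
        omega
      · have h1 : α 0 = 0 := by omega
        conv_rhs => rw [← Finsupp.cons_tail α, h1]
    · intro hsub
      obtain ⟨γ, -, hγ⟩ := hsub (a := Finsupp.single 0 1)
        ⟨Finsupp.single 0 1, by simp, by simp⟩
      simpa using DFunLike.congr_fun hγ 0⟩

/-! ### Term orders

A term order on `k[X]` is a `MonomialOrder`. -/

/-- `α ↦ (0, α)` as a homomorphism into the ordered monoid of a term order. -/
def consHom {n : ℕ} (m : MonomialOrder (Fin (n + 1))) : (Fin n →₀ ℕ) →+ m.syn where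
  toFun α := m.toSyn (Finsupp.cons 0 α)
  map_zero' := by simp
  map_add' α β := by
    rw [← map_add]
    congr 1
    ext i
    refine Fin.cases (by simp) (fun j => by simp) i

theorem consHom_injective {n : ℕ} (m : MonomialOrder (Fin (n + 1))) :
    Function.Injective (consHom m) :=
  m.toSyn.injective.comp (Finsupp.cons_right_injective 0)

/-- `consHom` as an additive equivalence onto its image. -/
def consEquiv {n : ℕ} (m : MonomialOrder (Fin (n + 1))) :
    (Fin n →₀ ℕ) ≃+ AddMonoidHom.mrange (consHom m) where
  toEquiv := Equiv.ofBijective (consHom m).mrangeRestrict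
    ⟨fun _ _ h => consHom_injective m (congrArg Subtype.val h),
      (consHom m).mrangeRestrict_surjective⟩
  map_add' := (consHom m).mrangeRestrict.map_add

/-- The restriction of a term order on `k[X₁, …, X_(n+1)]` to `k[X₂, …, X_(n+1)]`: exponents
`α, β ∈ ℕ^n` are compared as `(0, α)` and `(0, β)`. -/
def restrictOrder {n : ℕ} (m : MonomialOrder (Fin (n + 1))) : MonomialOrder (Fin n) where
  syn := AddMonoidHom.mrange (consHom m)
  addCommMonoidSyn := (AddMonoidHom.mrange (consHom m)).toAddCommMonoid
  toSyn := consEquiv m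
  toSyn_monotone := fun _ _ h => m.toSyn_monotone (cons_le_cons le_rfl h)

theorem restrictOrder_lt_iff {n : ℕ} (m : MonomialOrder (Fin (n + 1))) (α β : Fin n →₀ ℕ) :
    α ≺[restrictOrder m] β ↔ Finsupp.cons 0 α ≺[m] Finsupp.cons 0 β := Iff.rfl

/-- A product order: `α < β` if `p(α) < p(β)`, or `p(α) = p(β)` and `α₁ < β₁`. -/
def IsProductOrder {n : ℕ} (m : MonomialOrder (Fin (n + 1))) : Prop :=
  ∀ α β : Fin (n + 1) →₀ ℕ,
    (α.tail ≺[restrictOrder m] β.tail ∨ (α.tail = β.tail ∧ α 0 < β 0)) → α ≺[m] β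

/-! ### Standard sets of ideals and varieties

An affine variety in affine `N`-space over `K` is a closed subset of the prime spectrum of
`K[X₁, …, X_N]`, and its ideal is the (radical) ideal `PrimeSpectrum.vanishingIdeal`.
The coefficient ring `K` below is always a field; its field structure is not needed for the
definitions. -/

/-- The set of leading exponents of the nonzero elements of `I`. -/
def leadingExponents {N : ℕ} {K : Type*} [CommRing K] (m : MonomialOrder (Fin N))
    (I : Ideal (MvPolynomial (Fin N) K)) : Set (Fin N →₀ ℕ) :=
  {α | ∃ f ∈ I, f ≠ 0 ∧ m.degree f = α}

theorem leadingExponents_compl_mem {N : ℕ} {K : Type*} [CommRing K] (m : MonomialOrder (Fin N))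
    (I : Ideal (MvPolynomial (Fin N) K)) : (leadingExponents m I)ᶜ ∈ StandardSets N := by
  classical
  intro α hα β
  simp only [Set.mem_compl_iff, not_not] at hα ⊢
  obtain ⟨f, hf, hf0, rfl⟩ := hα
  have : Nontrivial K := by
    by_contra h
    rw [not_nontrivial_iff_subsingleton] at h
    exact hf0 (Subsingleton.elim _ _)
  have h1 : m.leadingCoeff f * m.leadingCoeff (monomial β (1 : K)) ≠ 0 := by
    rw [m.leadingCoeff_monomial, mul_one]
    exact m.leadingCoeff_ne_zero_iff.2 hf0
  refine ⟨f * monomial β 1, I.mul_mem_right _ hf, ?_, ?_⟩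
  · intro h0
    apply h1
    rw [← coeff_mul_of_degree_add, h0, coeff_zero]
  · rw [degree_mul_of_mul_leadingCoeff_ne_zero h1, degree_monomial, if_neg one_ne_zero]

/-- The standard set `D(I)`, the complement of the set of leading exponents. -/
def standardSet {N : ℕ} {K : Type*} [CommRing K] (m : MonomialOrder (Fin N))
    (I : Ideal (MvPolynomial (Fin N) K)) : StandardSets N :=
  ⟨(leadingExponents m I)ᶜ, leadingExponents_compl_mem m I⟩

/-- The standard set `D(A)` of the ideal of all polynomials vanishing on `A`. -/
def standardSetOf {N : ℕ} {K : Type*} [CommRing K] (m : MonomialOrder (Fin N))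
    (A : Set (PrimeSpectrum (MvPolynomial (Fin N) K))) : StandardSets N :=
  standardSet m (PrimeSpectrum.vanishingIdeal A)

/-- The closed subset of affine space defined by an affine subspace `P` of `k^N`: the common zeros
of the affine-linear polynomials that vanish on `P` (equivalently, of any system of linear
equations with solution set `P`). -/
def planeVariety {N : ℕ} {k : Type*} [Field k] (P : AffineSubspace k (Fin N → k)) :
    Set (PrimeSpectrum (MvPolynomial (Fin N) k)) :=
  PrimeSpectrum.zeroLocus {f | f.totalDegree ≤ 1 ∧ ∀ x ∈ P, eval x f = 0}

/-- `A` is a closed subvariety of affine `N`-space all of whose irreducible components are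
`d`-dimensional affine subspaces of `k^N`. -/
structure IsPlaneVariety {N : ℕ} {k : Type*} [Field k] (d : ℕ)
    (A : Set (PrimeSpectrum (MvPolynomial (Fin N) k))) : Prop where
  isClosed : IsClosed A
  components : ∀ Z, Maximal (fun Z => IsIrreducible Z ∧ Z ⊆ A) Z →
    ∃ P : AffineSubspace k (Fin N → k), (P : Set (Fin N → k)).Nonempty ∧
      Module.finrank k P.direction = d ∧ Z = planeVariety P

/-! ### Fibres over the closed points of the affine line

The closed points of the affine line are the maximal ideals `t` of `k[X₁]`, with the residue
field `k[X₁] ⧸ t`. -/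

/-- The map `k[X₁, …, X_(n+1)] → κ(t)[X₂, …, X_(n+1)]` that reduces `X₁` modulo `t`. -/
def specialize {n : ℕ} {k : Type*} [Field k] (t : MaximalSpectrum (Polynomial k)) :
    MvPolynomial (Fin (n + 1)) k →ₐ[k] MvPolynomial (Fin n) (Polynomial k ⧸ t.asIdeal) :=
  aeval (Fin.cons (C (Ideal.Quotient.mk t.asIdeal Polynomial.X)) X)

/-- The variety `A_t = A ∩ {X₁ = t}` in affine `n`-space over the residue field of `t`. -/
def slice {n : ℕ} {k : Type*} [Field k] (A : Set (PrimeSpectrum (MvPolynomial (Fin (n + 1)) k)))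
    (t : MaximalSpectrum (Polynomial k)) :
    Set (PrimeSpectrum (MvPolynomial (Fin n) (Polynomial k ⧸ t.asIdeal))) :=
  PrimeSpectrum.comap (specialize t).toRingHom ⁻¹' A

/-- The standard set `D(A_t)` with respect to the restricted term order. -/
def sliceStandardSet {n : ℕ} {k : Type*} [Field k] (m : MonomialOrder (Fin (n + 1)))
    (A : Set (PrimeSpectrum (MvPolynomial (Fin (n + 1)) k)))
    (t : MaximalSpectrum (Polynomial k)) : StandardSets n :=
  standardSetOf (restrictOrder m) (slice A t)

/-- The set of closed points `t` of the affine line with `D(A_t) = δ`. -/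
def constancySet {n : ℕ} {k : Type*} [Field k] (m : MonomialOrder (Fin (n + 1)))
    (A : Set (PrimeSpectrum (MvPolynomial (Fin (n + 1)) k))) (δ : StandardSets n) :
    Set (MaximalSpectrum (Polynomial k)) :=
  {t | sliceStandardSet m A t = δ}

end PlaneVarieties

end

noncomputable section

namespace PlaneVarieties

open MvPolynomial MonomialOrder

/-! ### Ideals generated by affine-linear polynomials -/

/-! Put `R = k[X₁]` and view `I(A)` as an ideal `J` of `R[X₂, …]` (`splitIdeal`). For a product
order the leading exponent of `f` is `(a, α)`, where `α` is the leading exponent of `f` over `R` and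
`a` is the degree of its leading coefficient in `R` (`degree_of_isProductOrder`). The set `δ` is the
complement of the leading exponents of nonzero elements of `J` over `R`.

Given this, the inclusions are short. A leading exponent of `I(A)` projects outside `δ`, so the
cuboid lies in `D(A)`. Conversely, over every `α ∉ δ` lies some leading exponent of `I(A)`, so no
line over `α` fits into `D(A)`. Finally, a leading coefficient in `R` vanishes at every `t` with `α
∈ D(A_t)`; since a nonzero polynomial has no more zeros than its degree, `a` is at least the number
of such `t`, which keeps `(a, α)` out of the sum.

The main work is `D(A_t) = δ` for almost all `t`. Three facts carry it: ideals generated by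
affine-linear polynomials are radical over every field, so each plane of `A` specializes without
acquiring nilpotents; intersecting the ideals of the planes commutes with reduction modulo `t` up to
a bounded torsion obstruction (`exists_ne_zero_smul_sub_smul_mem_iInf`); and leading exponents
survive reduction wherever finitely many leading coefficients do not vanish
(`exists_ne_zero_leading_specialization`). -/

theorem mem_span_one_X_of_totalDegree_le_one {σ K : Type*} [CommRing K] {f : MvPolynomial σ K}
    (hf : f.totalDegree ≤ 1) :
    f ∈ Submodule.span K (insert 1 (Set.range (X : σ → MvPolynomial σ K))) := by
  classical
  rw [f.as_sum]
  refine Submodule.sum_mem _ fun d hd => ?_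
  rw [← mul_one (coeff d f), ← smul_eq_mul, ← smul_monomial]
  refine Submodule.smul_mem _ _ (Submodule.subset_span ?_)
  have h1 : d.degree ≤ 1 := (le_totalDegree hd).trans hf
  rcases Nat.le_one_iff_eq_zero_or_eq_one.1 h1 with h0 | h0
  · rw [Finsupp.degree_eq_zero_iff] at h0
    subst h0
    exact Or.inl rfl
  · obtain ⟨i, hi⟩ : ∃ i, d i ≠ 0 := by
      by_contra! h
      simp [show d = 0 from Finsupp.ext h] at h0
    have hle : Finsupp.single i 1 ≤ d := by
      rw [Finsupp.single_le_iff]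
      omega
    obtain ⟨e, rfl⟩ := exists_add_of_le hle
    have he : e.degree = 0 := by
      rw [map_add, Finsupp.degree_single] at h0
      omega
    rw [Finsupp.degree_eq_zero_iff] at he
    subst he
    exact Or.inr ⟨i, by rw [add_zero]; rfl⟩

/-- An ideal generated by affine-linear polynomials over a field is the unit ideal or the kernel of
a linear substitution, hence radical. -/
theorem isRadical_span_of_subset_span_one_X {σ K : Type*} [Field K] {L : Set (MvPolynomial σ K)}
    (hL : L ⊆ Submodule.span K (insert 1 (Set.range (X : σ → MvPolynomial σ K)))) :
    (Ideal.span L).IsRadical := by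
  have hWI : ∀ w ∈ Submodule.span K L, w ∈ Ideal.span L := fun w hw =>
    (Submodule.span_le (p := (Ideal.span L).restrictScalars K)).2 Ideal.subset_span hw
  by_cases h1 : (1 : MvPolynomial σ K) ∈ Submodule.span K L
  · rw [(Ideal.eq_top_iff_one _).2 (hWI _ h1)]
    exact fun _ _ => trivial
  have hdis : Disjoint (Submodule.span K {(1 : MvPolynomial σ K)}) (Submodule.span K L) :=
    (Submodule.disjoint_span_singleton' one_ne_zero).2 h1 |>.symm
  -- The complement `D` of `span L` is chosen to contain `1`, so that the projection `ρ` onto `D`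
  -- fixes `1` and agrees on affine-linear polynomials with the algebra map `φ : X i ↦ ρ (X i)`.
  -- Hence `φ` kills `L`. As `φ` is the identity modulo the ideal, its kernel is no larger.
  obtain ⟨D, hD, hcompl⟩ := hdis.exists_isCompl
  let ρ : MvPolynomial σ K →ₗ[K] MvPolynomial σ K := D.projection _ hcompl
  have hρ1 : ρ 1 = 1 :=
    Submodule.projection_apply_left hcompl ⟨1, hD (Submodule.mem_span_singleton_self 1)⟩
  have hρW : ∀ w ∈ Submodule.span K L, ρ w = 0 := fun w hw =>
    (Submodule.projection_apply_eq_zero_iff hcompl).2 hw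
  have hρ : ∀ v, v - ρ v ∈ Submodule.span K L := fun v => by
    rw [← Submodule.projection_apply_eq_zero_iff hcompl]
    have := Submodule.projection_apply_left hcompl
      ⟨ρ v, Submodule.projection_apply_mem hcompl v⟩
    change ρ (v - ρ v) = 0
    rw [map_sub, sub_eq_zero]
    exact this.symm
  let φ : MvPolynomial σ K →ₐ[K] MvPolynomial σ K := aeval fun i => ρ (X i)
  have hφρ : ∀ v ∈ Submodule.span K (insert 1 (Set.range (X : σ → MvPolynomial σ K))),
      φ v = ρ v := fun v hv => by
    refine LinearMap.eqOn_span (f := φ.toLinearMap) (g := ρ) ?_ hv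
    rintro x (rfl | ⟨i, rfl⟩)
    · simp [hρ1]
    · simp [φ]
  have hker : Ideal.span L = RingHom.ker φ := by
    apply le_antisymm
    · rw [Ideal.span_le]
      intro w hw
      rw [SetLike.mem_coe, RingHom.mem_ker, hφρ w (hL hw), hρW w (Submodule.subset_span hw)]
    · have hcomp : (Ideal.Quotient.mkₐ K (Ideal.span L)).comp φ
          = Ideal.Quotient.mkₐ K (Ideal.span L) := by
        ext i
        simp only [φ, AlgHom.comp_apply, aeval_X]
        refine (Ideal.Quotient.eq.2 ?_).symm
        exact hWI _ (hρ _)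
      intro f hf
      rw [RingHom.mem_ker] at hf
      have := DFunLike.congr_fun hcomp f
      rw [AlgHom.comp_apply, hf, map_zero] at this
      exact Ideal.Quotient.eq_zero_iff_mem.1 this.symm
  rw [hker]
  exact (RingHom.ker_isPrime φ).isRadical

/-! ### Plane varieties and their fibres -/

/-- In a finite decomposition into irreducible closed sets, the maximal members are irreducible
components: an irreducible subset of `A` lies in one of the members. The other members are
redundant. -/
theorem IsPlaneVariety.exists_eq_biUnion {N d : ℕ} {k : Type*} [Field k]
    {A : Set (PrimeSpectrum (MvPolynomial (Fin N) k))} (hA : IsPlaneVariety d A) :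
    ∃ s : Finset (AffineSubspace k (Fin N → k)), A = ⋃ P ∈ s, planeVariety P := by
  classical
  obtain ⟨S, hSfin, hSc, hSi, hSA⟩ :=
    TopologicalSpace.NoetherianSpace.exists_finite_set_isClosed_irreducible hA.isClosed
  have hmax : ∀ Z ∈ S, ∃ W, Z ⊆ W ∧ Maximal (· ∈ S) W := fun Z hZ =>
    hSfin.exists_le_maximal hZ
  have hcomp : ∀ W, Maximal (· ∈ S) W →
      ∃ P : AffineSubspace k (Fin N → k), W = planeVariety P := by
    intro W hW
    obtain ⟨P, -, -, hP⟩ := hA.components W ⟨⟨hSi W hW.prop, by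
      rw [hSA]; exact Set.subset_sUnion_of_mem hW.prop⟩, by
        rintro Z ⟨hZi, hZA⟩ hWZ
        obtain ⟨T, hT, hZT⟩ := isIrreducible_iff_sUnion_isClosed.1 hZi hSfin.toFinset
          (fun z hz => hSc z (hSfin.mem_toFinset.1 hz)) (by simpa [← hSA] using hZA)
        exact hZT.trans (hW.2 (hSfin.mem_toFinset.1 hT) (hWZ.trans hZT))⟩
    exact ⟨P, hP⟩
  choose! P hP using hcomp
  have hfin : {W | Maximal (· ∈ S) W}.Finite := hSfin.subset fun W hW => hW.prop
  refine ⟨hfin.toFinset.image P, ?_⟩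
  apply Set.Subset.antisymm
  · rw [hSA]
    rintro x ⟨Z, hZ, hx⟩
    obtain ⟨W, hZW, hW⟩ := hmax Z hZ
    refine Set.mem_biUnion (x := P W) ?_ (by rw [← hP W hW]; exact hZW hx)
    exact Finset.mem_coe.2 (Finset.mem_image_of_mem P (hfin.mem_toFinset.2 hW))
  · refine Set.iUnion₂_subset fun Q hQ => ?_
    obtain ⟨W, hW, rfl⟩ := Finset.mem_image.1 hQ
    rw [hfin.mem_toFinset] at hW
    rw [← hP W hW, hSA]
    exact Set.subset_sUnion_of_mem hW.prop

theorem specialize_mem_span_one_X {n : ℕ} {k : Type*} [Field k]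
    (t : MaximalSpectrum (Polynomial k)) {f : MvPolynomial (Fin (n + 1)) k}
    (hf : f.totalDegree ≤ 1) :
    specialize t f ∈ Submodule.span (Polynomial k ⧸ t.asIdeal)
      (insert 1 (Set.range (X : Fin n → MvPolynomial (Fin n) (Polynomial k ⧸ t.asIdeal)))) := by
  have h : Submodule.span k (insert 1 (Set.range (X : Fin (n + 1) → MvPolynomial (Fin (n + 1)) k)))
      ≤ ((Submodule.span (Polynomial k ⧸ t.asIdeal)
      (insert 1 (Set.range (X : Fin n → MvPolynomial (Fin n)
        (Polynomial k ⧸ t.asIdeal))))).restrictScalars k).comap (specialize t).toLinearMap := by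
    rw [Submodule.span_le]
    rintro x (rfl | ⟨i, rfl⟩)
    · rw [SetLike.mem_coe, Submodule.mem_comap, AlgHom.toLinearMap_apply, map_one]
      exact Submodule.subset_span (Or.inl rfl)
    · refine Fin.cases ?_ (fun j => ?_) i
      · simp only [specialize, SetLike.mem_coe, Submodule.mem_comap, AlgHom.toLinearMap_apply,
          aeval_X, Fin.cons_zero, Submodule.restrictScalars_mem]
        rw [← mul_one (C _), ← smul_eq_C_mul]
        exact Submodule.smul_mem _ _ (Submodule.subset_span (Or.inl rfl))
      · simp only [specialize, SetLike.mem_coe, Submodule.mem_comap, AlgHom.toLinearMap_apply,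
          aeval_X, Fin.cons_succ, Submodule.restrictScalars_mem]
        exact Submodule.subset_span (Or.inr ⟨j, rfl⟩)
  exact h (mem_span_one_X_of_totalDegree_le_one hf)

/-- The slice is cut out by the reductions of affine-linear equations, and these already generate a
radical ideal over the residue field. This is where linearity enters: for the parabola `X₁ = X₂²` at
`X₁ = 0` the inclusion fails. -/
theorem vanishingIdeal_slice_planeVariety_le {n : ℕ} {k : Type*} [Field k]
    (t : MaximalSpectrum (Polynomial k)) (P : AffineSubspace k (Fin (n + 1) → k)) :
    PrimeSpectrum.vanishingIdeal (slice (planeVariety P) t) ≤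
      (PrimeSpectrum.vanishingIdeal (planeVariety P)).map (specialize t).toRingHom := by
  let _ : Field (Polynomial k ⧸ t.asIdeal) := Ideal.Quotient.field _
  rw [slice, planeVariety, PrimeSpectrum.preimage_comap_zeroLocus, ← PrimeSpectrum.zeroLocus_span,
    PrimeSpectrum.vanishingIdeal_zeroLocus_eq_radical]
  rw [(isRadical_span_of_subset_span_one_X ?_).radical, ← Ideal.map_span]
  · exact Ideal.map_mono (Ideal.span_le.2 (PrimeSpectrum.subset_vanishingIdeal_zeroLocus _))
  · rintro _ ⟨f, hf, rfl⟩
    exact specialize_mem_span_one_X t hf.1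

theorem map_vanishingIdeal_le_slice {n : ℕ} {k : Type*} [Field k]
    (t : MaximalSpectrum (Polynomial k))
    (A : Set (PrimeSpectrum (MvPolynomial (Fin (n + 1)) k))) :
    (PrimeSpectrum.vanishingIdeal A).map (specialize t).toRingHom ≤
      PrimeSpectrum.vanishingIdeal (slice A t) := by
  rw [Ideal.map_le_iff_le_comap]
  intro f hf
  rw [Ideal.mem_comap, PrimeSpectrum.mem_vanishingIdeal]
  intro x hx
  exact (PrimeSpectrum.mem_vanishingIdeal _ _).1 hf _ hx

/-! ### Leading exponents under specialization of the coefficients -/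

/-- The `R`-torsion of the cokernel of `S → ∏ i, S ⧸ I i` is annihilated by a single `g ≠ 0`. -/
theorem exists_ne_zero_smul_sub_smul_mem_iInf {R S ι : Type*} [CommRing R] [IsDomain R]
    [CommRing S] [IsNoetherianRing S] [Algebra R S] [Finite ι] (I : ι → Ideal S) :
    ∃ g : R, g ≠ 0 ∧ ∀ (r : R) (f : S), r ≠ 0 → (∀ i, ∃ b, f - r • b ∈ I i) →
      ∃ s, g • f - r • s ∈ ⨅ i, I i := by
  classical
  have hsm : ∀ (r : R) {x : S} (i : ι), x ∈ I i → r • x ∈ I i := fun r x i hx => by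
    rw [Algebra.smul_def]
    exact (I i).mul_mem_left _ hx
  -- `T` is the preimage in `S^ι` of the `R`-torsion of the cokernel. It is finitely generated, so
  -- the product of denominators of its generators serves all of it.
  let T : Submodule S (ι → S) :=
    { carrier := {b | ∃ r : R, r ≠ 0 ∧ ∃ s, ∀ i, r • b i - s ∈ I i}
      zero_mem' := ⟨1, one_ne_zero, 0, fun i => by simp⟩
      add_mem' := by
        rintro b c ⟨r, hr, s, hs⟩ ⟨r', hr', s', hs'⟩
        refine ⟨r * r', mul_ne_zero hr hr', r' • s + r • s', fun i => ?_⟩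
        convert (I i).add_mem (hsm r' i (hs i)) (hsm r i (hs' i)) using 1
        simp only [Pi.add_apply, Algebra.smul_def, map_mul]
        ring
      smul_mem' := by
        rintro a b ⟨r, hr, s, hs⟩
        refine ⟨r, hr, a * s, fun i => ?_⟩
        convert (I i).mul_mem_left a (hs i) using 1
        rw [Pi.smul_apply, smul_comm, smul_eq_mul, mul_sub] }
  obtain ⟨B, hB⟩ : T.FG := IsNoetherian.noetherian T
  have hBT : ∀ b ∈ B, ∃ r : R, r ≠ 0 ∧ ∃ s, ∀ i, r • b i - s ∈ I i := fun b hb =>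
    show b ∈ T from hB ▸ Submodule.subset_span hb
  choose! ρ hρ0 hρ using hBT
  have hg : ∀ b ∈ T, ∃ s, ∀ i, (∏ c ∈ B, ρ c) • b i - s ∈ I i := by
    intro b hb
    rw [← hB] at hb
    induction hb using Submodule.span_induction with
    | mem b hb =>
      obtain ⟨s, hs⟩ := hρ b hb
      refine ⟨(∏ c ∈ B.erase b, ρ c) • s, fun i => ?_⟩
      rw [← Finset.prod_erase_mul _ _ hb, mul_smul, ← smul_sub]
      exact hsm _ i (hs i)
    | zero => exact ⟨0, fun i => by simp⟩
    | add b c _ _ hb hc =>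
      obtain ⟨s, hs⟩ := hb
      obtain ⟨s', hs'⟩ := hc
      refine ⟨s + s', fun i => ?_⟩
      rw [Pi.add_apply, smul_add, add_sub_add_comm]
      exact (I i).add_mem (hs i) (hs' i)
    | smul a b _ hb =>
      obtain ⟨s, hs⟩ := hb
      refine ⟨a * s, fun i => ?_⟩
      rw [Pi.smul_apply, smul_comm, smul_eq_mul, ← mul_sub]
      exact (I i).mul_mem_left a (hs i)
  refine ⟨∏ c ∈ B, ρ c, Finset.prod_ne_zero_iff.2 hρ0, fun r f hr hf => ?_⟩
  choose b hb using hf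
  -- From `f ≡ r b_i` the tuple `b` lies in `T`, so `g b_i ≡ s` for one common `s`, and `g f ≡ r g
  -- b_i ≡ r s` modulo every `I i`.
  obtain ⟨s, hs⟩ := hg b ⟨r, hr, f, fun i => by simpa using (I i).neg_mem (hb i)⟩
  refine ⟨s, Ideal.mem_iInf.2 fun i => ?_⟩
  convert (I i).add_mem (hsm (∏ c ∈ B, ρ c) i (hb i)) (hsm r i (hs i)) using 1
  simp only [Algebra.smul_def]
  ring

theorem degree_map_of_leadingCoeff_ne_zero {σ R K : Type*} [CommRing R] [CommRing K]
    (m : MonomialOrder σ) (q : R →+* K) {f : MvPolynomial σ R} (hf : q (m.leadingCoeff f) ≠ 0) :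
    m.degree (map q f) = m.degree f := by
  apply m.toSyn.injective
  apply le_antisymm
  · rw [degree_le_iff]
    intro b hb
    exact m.le_degree (support_map_subset _ _ hb)
  · apply m.le_degree
    rw [mem_support_iff, coeff_map]
    exact hf

theorem map_ne_zero_of_leadingCoeff_ne_zero {σ R K : Type*} [CommRing R] [CommRing K]
    (m : MonomialOrder σ) (q : R →+* K) {f : MvPolynomial σ R} (hf : q (m.leadingCoeff f) ≠ 0) :
    map q f ≠ 0 := by
  intro h
  apply hf
  have := coeff_map q f (m.degree f)
  rw [h, coeff_zero] at this
  exact this.symm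

/-- An ideal over a domain has, for generic specializations of the coefficients, the same leading
exponents after specialization. -/
theorem exists_ne_zero_leading_specialization {σ R : Type*} [Finite σ] [CommRing R] [IsDomain R]
    (m : MonomialOrder σ) (J : Ideal (MvPolynomial σ R)) :
    ∃ h : R, h ≠ 0 ∧ ∀ {K : Type _} [CommRing K] [IsDomain K] (q : R →+* K), q h ≠ 0 →
      (∀ f ∈ J, f ≠ 0 → ∃ g ∈ J, map q g ≠ 0 ∧ m.degree (map q g) = m.degree f) ∧
      (∀ f ∈ J, map q f ≠ 0 → ∃ g ∈ J, g ≠ 0 ∧ m.degree g = m.degree (map q f)) := by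
  classical
  have := Fintype.ofFinite σ
  let E : Set (σ →₀ ℕ) := {α | ∃ f ∈ J, f ≠ 0 ∧ m.degree f = α}
  -- Dickson's lemma: `E` has finitely many minimal elements. The required `h` is the product of the
  -- leading coefficients of chosen `G α` attaining them.
  have hE : E.IsPWO := Set.isPWO_of_wellQuasiOrderedLE E
  have hfin : {α | Minimal (· ∈ E) α}.Finite :=
    (setOfPred_minimal_antichain _).finite_of_partiallyWellOrderedOn
      (hE.mono fun α hα => hα.prop)
  have hG : ∀ α, Minimal (· ∈ E) α → ∃ f ∈ J, f ≠ 0 ∧ m.degree f = α := fun α hα => hα.prop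
  choose! G hGJ hG0 hGd using hG
  refine ⟨∏ α ∈ hfin.toFinset, m.leadingCoeff (G α), Finset.prod_ne_zero_iff.2 fun α hα =>
    m.leadingCoeff_ne_zero_iff.2 (hG0 α (hfin.mem_toFinset.1 hα)), ?_⟩
  intro K _ _ q hq
  have hqG : ∀ α, Minimal (· ∈ E) α → q (m.leadingCoeff (G α)) ≠ 0 := fun α hα => by
    rw [map_prod] at hq
    exact Finset.prod_ne_zero_iff.1 hq α (hfin.mem_toFinset.2 hα)
  constructor
  · intro f hf hf0
    obtain ⟨α, hαf, hα⟩ := hE.exists_le_minimal (a := m.degree f) ⟨f, hf, hf0, rfl⟩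
    have h1 : m.leadingCoeff (monomial (m.degree f - α) (1 : R) * G α) = m.leadingCoeff (G α) := by
      rw [leadingCoeff_mul, leadingCoeff_monomial, one_mul]
    have h2 := hqG α hα
    rw [← h1] at h2
    refine ⟨_, J.mul_mem_left _ (hGJ α hα), map_ne_zero_of_leadingCoeff_ne_zero m q h2, ?_⟩
    rw [degree_map_of_leadingCoeff_ne_zero m q h2, degree_mul
      (monomial_eq_zero.not.2 one_ne_zero) (hG0 α hα), degree_monomial, if_neg one_ne_zero,
      hGd α hα, tsub_add_cancel_of_le hαf]
  · suffices H : ∀ (d : m.syn) (f : MvPolynomial σ R), m.toSyn (m.degree f) = d → f ∈ J →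
        map q f ≠ 0 → ∃ g ∈ J, g ≠ 0 ∧ m.degree g = m.degree (map q f) from
      fun f hf hf0 => H _ f rfl hf hf0
    intro d
    induction d using WellFoundedLT.induction with
    | ind d ih =>
    rintro f rfl hf hqf
    have hf0 : f ≠ 0 := by
      rintro rfl
      exact hqf (map_zero _)
    by_cases hlc : q (m.leadingCoeff f) = 0
    swap
    · exact ⟨f, hf, hf0, (degree_map_of_leadingCoeff_ne_zero m q hlc).symm⟩
    obtain ⟨α, hαf, hα⟩ := hE.exists_le_minimal (a := m.degree f) ⟨f, hf, hf0, rfl⟩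
    let c := m.leadingCoeff (G α)
    -- If `q` kills the leading coefficient of `f`, then `q` kills `u`. So `c f - u` has smaller
    -- degree, while its image is a nonzero constant times that of `f`.
    let u : MvPolynomial σ R := monomial (m.degree f - α) (m.leadingCoeff f) * G α
    have hlf : m.leadingCoeff f ≠ 0 := m.leadingCoeff_ne_zero_iff.2 hf0
    have hud : m.degree u = m.degree f := by
      rw [degree_mul (monomial_eq_zero.not.2 hlf) (hG0 α hα), degree_monomial, if_neg hlf,
        hGd α hα, tsub_add_cancel_of_le hαf]
    have hul : coeff (m.degree f) u = m.leadingCoeff f * c := by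
      rw [← hud]
      change m.leadingCoeff u = _
      rw [leadingCoeff_mul, leadingCoeff_monomial]
    have hmap : map q (C c * f - u) = C (q c) * map q f := by
      simp [u, hlc]
    have hqc : q c ≠ 0 := hqG α hα
    have hmap0 : map q (C c * f - u) ≠ 0 := by
      rw [hmap]
      exact mul_ne_zero (by simpa using hqc) hqf
    have hne : C c * f - u ≠ 0 := by
      intro h
      exact hmap0 (by rw [h, map_zero])
    have hlt : m.toSyn (m.degree (C c * f - u)) < m.toSyn (m.degree f) := by
      apply lt_of_le_of_ne
      · refine (m.degree_sub_le).trans (sup_le ?_ (le_of_eq (congrArg m.toSyn hud)))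
        refine m.degree_mul_le.trans ?_
        rw [degree_C, zero_add]
      · intro h
        have h' := m.toSyn.injective h
        have := m.coeff_degree_ne_zero_iff.2 hne
        rw [h', coeff_sub, coeff_C_mul, hul] at this
        exact this (sub_eq_zero.2 (mul_comm _ _))
    obtain ⟨g, hg, hg0, hgd⟩ := ih _ hlt _ rfl
      (J.sub_mem (J.mul_mem_left _ hf) (J.mul_mem_left _ (hGJ α hα))) hmap0
    refine ⟨g, hg, hg0, hgd.trans ?_⟩
    rw [hmap, degree_mul (by simpa using hqc) hqf, degree_C, zero_add]

theorem exists_ne_zero_leading_iInf {σ R ι : Type*} [Finite σ] [Finite ι] [CommRing R] [IsDomain R]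
    [IsPrincipalIdealRing R] (m : MonomialOrder σ) (I : ι → Ideal (MvPolynomial σ R)) :
    ∃ h : R, h ≠ 0 ∧ ∀ t : MaximalSpectrum R, h ∉ t.asIdeal →
      (∀ f ∈ ⨅ i, I i, f ≠ 0 → ∃ g ∈ ⨅ i, I i, map (Ideal.Quotient.mk t.asIdeal) g ≠ 0 ∧
        m.degree (map (Ideal.Quotient.mk t.asIdeal) g) = m.degree f) ∧
      (∀ f ∈ ⨅ i, (I i).map (map (Ideal.Quotient.mk t.asIdeal)), f ≠ 0 →
        ∃ g ∈ ⨅ i, I i, g ≠ 0 ∧ m.degree g = m.degree f) := by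
  obtain ⟨h, h0, hh⟩ := exists_ne_zero_leading_specialization m (⨅ i, I i)
  obtain ⟨g, g0, hg⟩ := exists_ne_zero_smul_sub_smul_mem_iInf (R := R) I
  refine ⟨h * g, mul_ne_zero h0 g0, fun t ht => ?_⟩
  have hht : h ∉ t.asIdeal := fun H => ht (t.asIdeal.mul_mem_right _ H)
  have hgt : g ∉ t.asIdeal := fun H => ht (t.asIdeal.mul_mem_left _ H)
  obtain ⟨h1, h2⟩ := hh (Ideal.Quotient.mk t.asIdeal) (Ideal.Quotient.eq_zero_iff_mem.not.2 hht)
  refine ⟨h1, fun f hf hf0 => ?_⟩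
  have hsurj : Function.Surjective (map (σ := σ) (Ideal.Quotient.mk t.asIdeal)) :=
    map_surjective _ Ideal.Quotient.mk_surjective
  obtain ⟨F, rfl⟩ := hsurj f
  obtain ⟨r, hr⟩ := IsPrincipalIdealRing.principal t.asIdeal
  have hr' : ∀ a, Ideal.Quotient.mk t.asIdeal a = 0 ↔ r ∣ a := fun a => by
    rw [Ideal.Quotient.eq_zero_iff_mem, hr]
    exact Ideal.mem_span_singleton
  have hqr : Ideal.Quotient.mk t.asIdeal r = 0 := (hr' r).2 dvd_rfl
  have hqg : Ideal.Quotient.mk t.asIdeal g ≠ 0 := Ideal.Quotient.eq_zero_iff_mem.not.2 hgt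
  -- `F` lies in `I i + r S` for every `i`, which is the situation covered by `g`. If `r = 0`,
  -- reduction is injective and `F` itself lies in every `I i`.
  have key : ∃ s, g • F - r • s ∈ ⨅ i, I i := by
    by_cases hr0 : r = 0
    · refine ⟨0, ?_⟩
      rw [smul_zero, sub_zero, smul_eq_C_mul]
      refine Ideal.mul_mem_left _ _ (Ideal.mem_iInf.2 fun i => ?_)
      obtain ⟨F', hF', he⟩ := (Ideal.mem_map_iff_of_surjective _ hsurj).1 (Ideal.mem_iInf.1 hf i)
      have : C r ∣ F' - F := (C_dvd_iff_map_hom_eq_zero _ r hr' _).2 (by rw [map_sub, he, sub_self])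
      rw [hr0, C_0, zero_dvd_iff, sub_eq_zero] at this
      rwa [← this]
    · refine hg r F hr0 fun i => ?_
      obtain ⟨F', hF', he⟩ := (Ideal.mem_map_iff_of_surjective _ hsurj).1 (Ideal.mem_iInf.1 hf i)
      obtain ⟨b, hb⟩ : C r ∣ F - F' :=
        (C_dvd_iff_map_hom_eq_zero _ r hr' _).2 (by rw [map_sub, he, sub_self])
      refine ⟨b, ?_⟩
      rw [smul_eq_C_mul, ← hb, sub_sub_cancel]
      exact hF'
  obtain ⟨s, hs⟩ := key
  have hmap : map (Ideal.Quotient.mk t.asIdeal) (g • F - r • s)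
      = C (Ideal.Quotient.mk t.asIdeal g) * map (Ideal.Quotient.mk t.asIdeal) F := by
    simp [smul_eq_C_mul, hqr]
  have hC : (C (Ideal.Quotient.mk t.asIdeal g) : MvPolynomial σ (R ⧸ t.asIdeal)) ≠ 0 := by
    simpa using hqg
  obtain ⟨G, hG, hG0, hGd⟩ := h2 _ hs (by rw [hmap]; exact mul_ne_zero hC hf0)
  refine ⟨G, hG, hG0, hGd.trans ?_⟩
  rw [hmap, degree_mul hC hf0, degree_C, zero_add]

/-! ### Closed points of the affine line -/

theorem exists_maximalSpectrum_notMem {k : Type*} [Field k] {f : Polynomial k} (hf : f ≠ 0) :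
    ∃ t : MaximalSpectrum (Polynomial k), f ∉ t.asIdeal := by
  -- Euclid's argument, valid over finite fields too: a maximal ideal containing `X * f + 1` cannot
  -- contain `f`.
  have hu : Polynomial.X * f + 1 ∈ nonunits (Polynomial k) := by
    intro h
    have h0 := Polynomial.natDegree_eq_zero_of_isUnit h
    rw [← Polynomial.C_1, Polynomial.natDegree_add_C, Polynomial.natDegree_X_mul hf] at h0
    omega
  obtain ⟨t, ht, hmem⟩ := exists_max_ideal_of_mem_nonunits hu
  refine ⟨⟨t, ht⟩, fun h => ht.ne_top ((Ideal.eq_top_iff_one _).2 ?_)⟩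
  exact (Ideal.add_mem_iff_right t (t.mul_mem_left _ h)).1 hmem

theorem card_le_natDegree {k : Type*} [Field k] {f : Polynomial k} (hf : f ≠ 0)
    {s : Finset (MaximalSpectrum (Polynomial k))} (hs : ∀ t ∈ s, f ∈ t.asIdeal) :
    s.card ≤ f.natDegree := by
  classical
  have hp : ∀ t : MaximalSpectrum (Polynomial k), ∃ p, t.asIdeal = Ideal.span {p} := fun t =>
    (IsPrincipalIdealRing.principal t.asIdeal).principal
  choose p hp using hp
  have hdvd : ∀ t ∈ s, p t ∣ f := fun t ht => by
    rw [← Ideal.mem_span_singleton, ← hp]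
    exact hs t ht
  -- Generators of distinct maximal ideals are coprime, so their product divides `f`, and each
  -- contributes degree at least one.
  have hcop : (s : Set (MaximalSpectrum (Polynomial k))).Pairwise
      (Function.onFun IsCoprime p) := fun t _ u _ htu => by
    rw [Function.onFun, ← Ideal.isCoprime_span_singleton_iff, ← hp, ← hp]
    rw [Ideal.isCoprime_iff_sup_eq]
    exact Ideal.IsMaximal.coprime_of_ne t.isMaximal u.isMaximal
      fun h => htu (MaximalSpectrum.ext h)
  have hp0 : ∀ t ∈ s, p t ≠ 0 := fun t ht h => hf (by
    have := hdvd t ht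
    rwa [h, zero_dvd_iff] at this)
  calc s.card = ∑ t ∈ s, 1 := by simp
    _ ≤ ∑ t ∈ s, (p t).natDegree := by
        refine Finset.sum_le_sum fun t ht => Nat.one_le_iff_ne_zero.2 fun h => ?_
        refine t.isMaximal.ne_top ?_
        rw [hp, Ideal.span_singleton_eq_top]
        exact Polynomial.isUnit_iff_degree_eq_zero.2
          (by rw [Polynomial.degree_eq_natDegree (hp0 t ht), h]; rfl)
    _ = (∏ t ∈ s, p t).natDegree := (Polynomial.natDegree_prod _ _ hp0).symm
    _ ≤ f.natDegree := Polynomial.natDegree_le_of_dvd (Finset.prod_dvd_of_coprime hcop hdvd) hf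

theorem finite_maximalSpectrum_mem {k : Type*} [Field k] {f : Polynomial k} (hf : f ≠ 0) :
    {t : MaximalSpectrum (Polynomial k) | f ∈ t.asIdeal}.Finite := by
  by_contra h
  obtain ⟨s, hs, hcard⟩ := Set.Infinite.exists_subset_card_eq h (f.natDegree + 1)
  have := card_le_natDegree hf (s := s) fun t ht => hs ht
  omega

theorem dense_of_forall_notMem {k : Type*} [Field k] {f : Polynomial k} (hf : f ≠ 0)
    {U : Set (MaximalSpectrum (Polynomial k))} (hU : ∀ t, f ∉ t.asIdeal → t ∈ U) : Dense U := by
  rw [dense_iff_inter_open]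
  rintro O hO ⟨t, ht⟩
  obtain ⟨V, hV, rfl⟩ := isOpen_induced_iff.1 hO
  obtain ⟨_, ⟨g, rfl⟩, hg, hgV⟩ :=
    PrimeSpectrum.isTopologicalBasis_basic_opens.exists_subset_of_mem_open ht hV
  have hg0 : g ≠ 0 := by
    rintro rfl
    exact hg (Submodule.zero_mem _)
  obtain ⟨u, hu⟩ := exists_maximalSpectrum_notMem (mul_ne_zero hf hg0)
  exact ⟨u, hgV fun h => hu (u.asIdeal.mul_mem_left _ h), hU u fun h => hu
    (u.asIdeal.mul_mem_right _ h)⟩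

/-! ### Splitting off the first variable -/

/-- The isomorphism `k[X₁, …, X_(n+1)] ≃ k[X₁][X₂, …, X_(n+1)]`. -/
def splitFirst (k : Type*) [Field k] (n : ℕ) :
    MvPolynomial (Fin (n + 1)) k ≃ₐ[k] MvPolynomial (Fin n) (Polynomial k) :=
  (renameEquiv k (_root_.finSuccEquiv n)).trans (optionEquivRight k (Fin n))

theorem splitFirst_X_zero {k : Type*} [Field k] {n : ℕ} :
    splitFirst k n (X 0) = C Polynomial.X := by
  simp [splitFirst]

theorem splitFirst_X_succ {k : Type*} [Field k] {n : ℕ} (i : Fin n) :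
    splitFirst k n (X i.succ) = X i := by
  simp [splitFirst]

theorem splitFirst_monomial {k : Type*} [Field k] {n : ℕ} (d : Fin (n + 1) →₀ ℕ) (c : k) :
    splitFirst k n (monomial d c) = monomial d.tail (Polynomial.monomial (d 0) c) := by
  have h0 : splitFirst k n (C c) = C (Polynomial.C c) := (splitFirst k n).commutes c
  rw [monomial_eq, monomial_eq, map_mul, h0, Finsupp.prod_fintype _ _ (by simp),
    Finsupp.prod_fintype _ _ (by simp), Fin.prod_univ_succ, map_mul, map_pow, map_prod,
    splitFirst_X_zero, ← Polynomial.C_mul_X_pow_eq_monomial, map_mul, map_pow, mul_assoc]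
  simp only [map_pow, splitFirst_X_succ, Finsupp.tail_apply]

theorem coeff_coeff_splitFirst {k : Type*} [Field k] {n : ℕ} (f : MvPolynomial (Fin (n + 1)) k)
    (d : Fin (n + 1) →₀ ℕ) : (coeff d.tail (splitFirst k n f)).coeff (d 0) = coeff d f := by
  classical
  induction f using MvPolynomial.induction_on' with
  | monomial e c =>
    rw [splitFirst_monomial, coeff_monomial, coeff_monomial]
    by_cases h : e = d
    · subst h
      simp
    · rw [if_neg h]
      split_ifs with h1
      · rw [Polynomial.coeff_monomial, if_neg]
        intro h2
        apply h
        rw [← Finsupp.cons_tail e, ← Finsupp.cons_tail d, h1, h2]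
      · simp
  | add p q hp hq => rw [map_add, coeff_add, Polynomial.coeff_add, hp, hq, coeff_add]

/-- This turns passing to the fibre over `t` into reduction of coefficients, to which the
specialization results apply. -/
theorem specialize_eq {n : ℕ} {k : Type*} [Field k] (t : MaximalSpectrum (Polynomial k)) :
    (specialize t : MvPolynomial (Fin (n + 1)) k →ₐ[k] _).toRingHom
      = (map (Ideal.Quotient.mk t.asIdeal)).comp (splitFirst k n).toRingEquiv.toRingHom := by
  refine MvPolynomial.ringHom_ext (fun c => ?_) (fun i => ?_)
  · have h0 : splitFirst k n (C c) = C (Polynomial.C c) := (splitFirst k n).commutes c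
    have h1 : specialize (n := n) t (C c) = algebraMap k _ c := (specialize t).commutes c
    change specialize t (C c) = map _ (splitFirst k n (C c))
    rw [h0, h1, map_C]
    rfl
  · change specialize t (X i) = map _ (splitFirst k n (X i))
    rw [specialize, aeval_X]
    refine Fin.cases ?_ (fun j => ?_) i
    · rw [splitFirst_X_zero, map_C, Fin.cons_zero]
    · rw [splitFirst_X_succ, map_X, Fin.cons_succ]

/-- The order compares `p` first, so the terms with largest `p` win; together they form the leading
coefficient over `k[X₁]`, and among them the highest power of `X₁` decides. -/
theorem degree_of_isProductOrder {k : Type*} [Field k] {n : ℕ} {m : MonomialOrder (Fin (n + 1))}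
    (hm : IsProductOrder m) {f : MvPolynomial (Fin (n + 1)) k} (hf : f ≠ 0) :
    m.degree f = Finsupp.cons ((restrictOrder m).leadingCoeff (splitFirst k n f)).natDegree
      ((restrictOrder m).degree (splitFirst k n f)) := by
  set F := splitFirst k n f
  have hF : F ≠ 0 := (splitFirst k n).toRingEquiv.map_ne_zero_iff.2 hf
  have hlc : (restrictOrder m).leadingCoeff F ≠ 0 := (restrictOrder m).leadingCoeff_ne_zero_iff.2 hF
  apply m.toSyn.injective
  apply le_antisymm
  · rw [degree_le_iff]
    intro d hd
    rw [mem_support_iff, ← coeff_coeff_splitFirst] at hd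
    have hdF : d.tail ∈ F.support := by
      rw [mem_support_iff]
      intro h
      exact hd (by rw [show coeff d.tail (splitFirst k n f) = 0 from h, Polynomial.coeff_zero])
    rcases ((restrictOrder m).le_degree hdF).lt_or_eq with h | h
    · refine (hm _ _ (Or.inl ?_)).le
      rw [Finsupp.tail_cons]
      exact h
    · have h := (restrictOrder m).toSyn.injective h
      have hle : d 0 ≤ ((restrictOrder m).leadingCoeff F).natDegree := by
        apply Polynomial.le_natDegree_of_ne_zero
        rw [MonomialOrder.leadingCoeff, ← h]
        exact hd
      rcases hle.lt_or_eq with h0 | h0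
      · refine (hm _ _ (Or.inr ⟨?_, ?_⟩)).le
        · rw [Finsupp.tail_cons, h]
        · rwa [Finsupp.cons_zero]
      · rw [← h, ← h0, Finsupp.cons_tail]
  · apply m.le_degree
    rw [mem_support_iff, ← coeff_coeff_splitFirst, Finsupp.tail_cons, Finsupp.cons_zero]
    exact Polynomial.leadingCoeff_ne_zero.2 hlc

/-! ### Sums of embedded standard sets -/

theorem ncard_fibre_sum {n : ℕ} {ι : Type*} (s : Finset ι) (δ : ι → BoundedStandardSets n)
    (α : Fin n →₀ ℕ) :
    (fibre (∑ i ∈ s, δ i).1 α).ncard = ∑ i ∈ s, (fibre (δ i).1 α).ncard := by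
  classical
  induction s using Finset.induction_on with
  | empty => simpa using ncard_fibre_zero α
  | insert i s hi ih => rw [Finset.sum_insert hi, Finset.sum_insert hi, ncard_fibre_add, ih]

open Classical in
theorem ncard_fibre_embed {n : ℕ} (δ : StandardSets n) (α : Fin n →₀ ℕ) :
    (fibre (embed δ).1 α).ncard = if α ∈ δ.1 then 1 else 0 := by
  have h : fibre (embed δ).1 α = if α ∈ δ.1 then {Finsupp.cons 0 α} else ∅ := by
    ext γ
    simp only [fibre, embed]
    constructor
    · rintro ⟨⟨β, hβ, rfl⟩, rfl⟩
      rw [Finsupp.tail_cons, if_pos hβ]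
      rfl
    · intro hγ
      split_ifs at hγ with hα
      · rw [Set.mem_singleton_iff.1 hγ]
        exact ⟨⟨α, hα, rfl⟩, Finsupp.tail_cons _ _⟩
      · exact hγ.elim
  rw [h]
  split_ifs <;> simp

-- An embedded standard set has at most one point in each fibre, so the height of the sum over
-- `p(β)` counts the summands that contain `p(β)`.
open Classical in
theorem mem_sum_embed {n : ℕ} {ι : Type*} (s : Finset ι) (δ : ι → StandardSets n)
    (β : Fin (n + 1) →₀ ℕ) :
    β ∈ (∑ i ∈ s, embed (δ i)).1 ↔ β 0 < (s.filter fun i => β.tail ∈ (δ i).1).card := by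
  rw [mem_iff_lt_ncard (∑ i ∈ s, embed (δ i)).2, ncard_fibre_sum, Finset.card_filter]
  simp only [ncard_fibre_embed]

theorem mem_coordPlane_zero {n : ℕ} {α γ : Fin (n + 1) →₀ ℕ} (hγ : γ 0 = 0) :
    α ∈ coordPlane {0} γ ↔ α.tail = γ.tail := by
  constructor
  · rintro ⟨β, hβ, rfl⟩
    ext j
    have : β j.succ = 0 := by
      by_contra hne
      simpa using hβ (Finsupp.mem_support_iff.2 hne)
    simp [Finsupp.tail_apply, this]
  · intro h
    refine ⟨Finsupp.single 0 (α 0), Finsupp.support_single_subset, ?_⟩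
    ext i
    refine Fin.cases (by simp [hγ]) (fun j => ?_) i
    simpa [Finsupp.tail_apply] using DFunLike.congr_fun h j

theorem isUnionOfPlanes_cuboid {n : ℕ} (δ : Set (Fin n →₀ ℕ)) : IsUnionOfPlanes {0} (cuboid δ) := by
  refine ⟨Finsupp.cons 0 '' δ, ?_, ?_⟩
  · rintro _ ⟨α, -, rfl⟩ j hj
    rw [Finset.mem_singleton.1 hj, Finsupp.cons_zero]
  · ext β
    simp only [cuboid, Set.mem_ofPred_eq, Set.mem_iUnion, exists_prop]
    constructor
    · intro hβ
      refine ⟨_, ⟨β.tail, hβ, rfl⟩, (mem_coordPlane_zero (Finsupp.cons_zero _ _)).2 ?_⟩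
      rw [Finsupp.tail_cons]
    · rintro ⟨_, ⟨α, hα, rfl⟩, hβ⟩
      rw [mem_coordPlane_zero (Finsupp.cons_zero _ _), Finsupp.tail_cons] at hβ
      rwa [hβ]

/-! ### The standard sets of the fibres of a plane variety -/

section

variable {k : Type*} [Field k] {n : ℕ}

/-- The ideal of `A` in `k[X₁][X₂, …, X_(n+1)]`. -/
def splitIdeal (A : Set (PrimeSpectrum (MvPolynomial (Fin (n + 1)) k))) :
    Ideal (MvPolynomial (Fin n) (Polynomial k)) :=
  (PrimeSpectrum.vanishingIdeal A).map (splitFirst k n).toRingEquiv.toRingHom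

theorem mem_splitIdeal {A : Set (PrimeSpectrum (MvPolynomial (Fin (n + 1)) k))}
    {F : MvPolynomial (Fin n) (Polynomial k)} :
    F ∈ splitIdeal A ↔ (splitFirst k n).symm F ∈ PrimeSpectrum.vanishingIdeal A := by
  have hsurj : Function.Surjective (splitFirst k n).toRingEquiv.toRingHom :=
    (splitFirst k n).surjective
  rw [splitIdeal, Ideal.mem_map_iff_of_surjective _ hsurj]
  constructor
  · rintro ⟨f, hf, rfl⟩
    change (splitFirst k n).symm (splitFirst k n f) ∈ _
    rwa [AlgEquiv.symm_apply_apply]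
  · exact fun h => ⟨_, h, (splitFirst k n).apply_symm_apply F⟩

theorem splitIdeal_biUnion {ι : Type*} (s : Finset ι)
    (Z : ι → Set (PrimeSpectrum (MvPolynomial (Fin (n + 1)) k))) :
    splitIdeal (⋃ i ∈ s, Z i) = ⨅ i : s, splitIdeal (Z i) := by
  ext F
  simp only [mem_splitIdeal, PrimeSpectrum.vanishingIdeal_iUnion, Ideal.mem_iInf, Subtype.forall]

theorem map_splitIdeal (A : Set (PrimeSpectrum (MvPolynomial (Fin (n + 1)) k)))
    (t : MaximalSpectrum (Polynomial k)) :
    (splitIdeal A).map (map (Ideal.Quotient.mk t.asIdeal))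
      = (PrimeSpectrum.vanishingIdeal A).map (specialize t).toRingHom := by
  rw [splitIdeal, Ideal.map_map, specialize_eq]

theorem map_mem_vanishingIdeal_slice {A : Set (PrimeSpectrum (MvPolynomial (Fin (n + 1)) k))}
    (t : MaximalSpectrum (Polynomial k)) {F : MvPolynomial (Fin n) (Polynomial k)}
    (hF : F ∈ splitIdeal A) :
    map (Ideal.Quotient.mk t.asIdeal) F ∈ PrimeSpectrum.vanishingIdeal (slice A t) := by
  apply map_vanishingIdeal_le_slice
  rw [← map_splitIdeal]
  exact Ideal.mem_map_of_mem _ hF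

/-- The leading coefficient vanishes at the closed points whose standard set contains the leading
exponent. -/
theorem leadingCoeff_mem_of_degree_mem (m : MonomialOrder (Fin (n + 1)))
    {A : Set (PrimeSpectrum (MvPolynomial (Fin (n + 1)) k))} (t : MaximalSpectrum (Polynomial k))
    {F : MvPolynomial (Fin n) (Polynomial k)} (hF : F ∈ splitIdeal A)
    (h : (restrictOrder m).degree F ∈ (sliceStandardSet m A t).1) :
    (restrictOrder m).leadingCoeff F ∈ t.asIdeal := by
  by_contra hlc
  rw [← Ideal.Quotient.eq_zero_iff_mem] at hlc
  exact h ⟨_, map_mem_vanishingIdeal_slice t hF, map_ne_zero_of_leadingCoeff_ne_zero _ _ hlc,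
    degree_map_of_leadingCoeff_ne_zero _ _ hlc⟩

/-- Reduction always maps `J` into `I(A_t)`. Conversely, `I(A_t)` lies in the intersection of the
reduced ideals of the planes, whose leading exponents all come from `J` when `h ∉ t`. -/
theorem IsPlaneVariety.exists_sliceStandardSet_eq {d : ℕ} (m : MonomialOrder (Fin (n + 1)))
    {A : Set (PrimeSpectrum (MvPolynomial (Fin (n + 1)) k))} (hA : IsPlaneVariety d A) :
    ∃ h : Polynomial k, h ≠ 0 ∧ ∀ t : MaximalSpectrum (Polynomial k), h ∉ t.asIdeal →
      sliceStandardSet m A t = standardSet (restrictOrder m) (splitIdeal A) := by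
  obtain ⟨s, rfl⟩ := hA.exists_eq_biUnion
  obtain ⟨h, h0, hh⟩ := exists_ne_zero_leading_iInf (restrictOrder m)
    fun P : s => splitIdeal (planeVariety P.1)
  refine ⟨h, h0, fun t ht => Subtype.ext (congrArg compl ?_)⟩
  obtain ⟨h1, h2⟩ := hh t ht
  rw [← splitIdeal_biUnion] at h1 h2
  apply Set.Subset.antisymm
  · rintro α ⟨f, hf, hf0, rfl⟩
    refine h2 f (Ideal.mem_iInf.2 fun P => ?_) hf0
    rw [map_splitIdeal]
    apply vanishingIdeal_slice_planeVariety_le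
    refine PrimeSpectrum.vanishingIdeal_anti_mono (fun x hx => ?_) hf
    exact Set.mem_biUnion P.2 hx
  · rintro α ⟨f, hf, hf0, rfl⟩
    obtain ⟨g, hg, hg0, hgd⟩ := h1 f hf hf0
    exact ⟨_, map_mem_vanishingIdeal_slice t hg, hg0, hgd⟩

end

end PlaneVarieties
end

open PlaneVarieties in
theorem corollary6p1 {k : Type*} [Field k] {n d : ℕ}
    (m : MonomialOrder (Fin (n + 1))) (hm : IsProductOrder m)
    (A : Set (PrimeSpectrum (MvPolynomial (Fin (n + 1)) k))) (hA : IsPlaneVariety d A) :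
    ∃ δ : StandardSets n,
      Dense (constancySet m A δ) ∧
      (∃ hY : (constancySet m A δ)ᶜ.Finite,
        cuboid (δ : Set (Fin n →₀ ℕ)) ∪
            ((∑ t ∈ hY.toFinset, embed (sliceStandardSet m A t) : BoundedStandardSets n) :
              Set (Fin (n + 1) →₀ ℕ)) ⊆
          (standardSetOf m A : Set (Fin (n + 1) →₀ ℕ))) ∧
      IsGreatest
        {S : Set (Fin (n + 1) →₀ ℕ) |
          S ⊆ (standardSetOf m A : Set (Fin (n + 1) →₀ ℕ)) ∧ IsUnionOfPlanes {0} S}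
        (cuboid (δ : Set (Fin n →₀ ℕ))) := by
  classical
  obtain ⟨h, h0, hh⟩ := hA.exists_sliceStandardSet_eq m
  have hmem : ∀ f ∈ PrimeSpectrum.vanishingIdeal A, splitFirst k n f ∈ splitIdeal A := fun f hf =>
    mem_splitIdeal.2 (by rwa [AlgEquiv.symm_apply_apply])
  have hne : ∀ f : MvPolynomial (Fin (n + 1)) k, f ≠ 0 → splitFirst k n f ≠ 0 := fun f hf =>
    (splitFirst k n).toRingEquiv.map_ne_zero_iff.2 hf
  have hcub : cuboid (standardSet (restrictOrder m) (splitIdeal A) : Set (Fin n →₀ ℕ)) ⊆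
      (standardSetOf m A : Set (Fin (n + 1) →₀ ℕ)) := by
    rintro β hβ ⟨f, hf, hf0, rfl⟩
    rw [degree_of_isProductOrder hm hf0] at hβ
    refine hβ ⟨_, hmem f hf, hne f hf0, ?_⟩
    rw [Finsupp.tail_cons]
  refine ⟨standardSet (restrictOrder m) (splitIdeal A), dense_of_forall_notMem h0 hh,
    ⟨(finite_maximalSpectrum_mem h0).subset fun t ht => ?_, Set.union_subset hcub ?_⟩,
    ⟨hcub, isUnionOfPlanes_cuboid _⟩, ?_⟩
  · by_contra hht
    exact ht (hh t hht)
  · rintro β hβ ⟨f, hf, hf0, rfl⟩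
    rw [mem_sum_embed] at hβ
    refine hβ.not_ge ?_
    rw [degree_of_isProductOrder hm hf0, Finsupp.cons_zero, Finsupp.tail_cons]
    -- The first entry of the leading exponent is the degree of a polynomial in `X₁` vanishing at
    -- every `t` counted by the sum.
    refine card_le_natDegree (MonomialOrder.leadingCoeff_ne_zero_iff.2 (hne f hf0)) fun t ht => ?_
    exact leadingCoeff_mem_of_degree_mem m t (hmem f hf) (Finset.mem_filter.1 ht).2
  · rintro S ⟨hS, Γ, hΓ, rfl⟩ β hβ
    obtain ⟨γ, hγ, hβγ⟩ := Set.mem_iUnion₂.1 hβ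
    have hγ0 : γ 0 = 0 := hΓ γ hγ 0 (Finset.mem_singleton_self 0)
    rw [mem_coordPlane_zero hγ0] at hβγ
    rintro ⟨F, hF, hF0, hFd⟩
    -- If `p(β) ∉ δ`, the witness `F` yields a leading exponent of `I(A)` on the line over `p(β) =
    -- p(γ)`, yet that whole line lies in `S ⊆ D(A)`.
    have hf0 : (splitFirst k n).symm F ≠ 0 :=
      (splitFirst k n).symm.toRingEquiv.map_ne_zero_iff.2 hF0
    have hd := degree_of_isProductOrder hm hf0
    rw [AlgEquiv.apply_symm_apply, hFd] at hd
    refine hS (Set.mem_biUnion hγ ((mem_coordPlane_zero hγ0).2 ?_))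
      ⟨_, mem_splitIdeal.1 hF, hf0, hd⟩
    rw [Finsupp.tail_cons, hβγ]
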